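/- A monoid $M$ is \emph{Noetherian} if for every $a\in M$ there is an integer $n$ such that $a$ is not a product of more than $n$ nonidentity elements; it is \emph{Gaussian} if it is Noetherian, cancellative, and every two elements have a least common multiple with respect to left divisibility ($b\in aM$) and one with respect to right divisibility ($b\in Ma$). A \emph{Garside group} is a group $G$ with a finite subset $S$ (the \emph{simple elements}) and an element $\Delta$ such that the submonoid $G^+$ generated by $S$ is Gaussian, $G$ is the group of fractions of $G^+$, $\Delta\in G^+$ has the same left and right divisors in $G^+$, and $S$ is the set of divisors of $\Delta$ in $G^+$. For $a=(a_1,\dots,a_r)\in G^r$ and $x\in G$ let $a^x=(x^{-1}a_1x,\dots,x^{-1}a_rx)$ and $a^G=\{a^x: x\in G\}$. Write $b\le c$ in $G$ if $c=dbd'$ for some $d,d'\in G^+$, and for $p,q\in\mathbb{Z}^r$ let $[p,q]=\{a\in G^r:\Delta^{p_i}\le a_i\le\Delta^{q_i}\text{ for } i=1,\dots,r\}$. \textbf{Theorem.} Let $(G,S,\Delta)$ be a Garside group, and let elements of $G$ be given by words in some fixed finite generating set of $G$ and its inverses. Then the simultaneous conjugacy problem in $G$ is solvable, in its decision and its search version: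 there are algorithms that, given $r$ and $a,c\in G^r$, decide whether $c\in a^G$ and, if so, find some $x\in G$ with $a^x=c$. More precisely: (1) there is an algorithm that, given $a,c\in G^r$, finds $p,q\in\mathbb{Z}^r$ such that $a,c\in[p,q]$; (2) for all $p,q\in\mathbb{Z}^r$ and $a\in[p,q]$, the set $a^G\cap[p,q]$ is finite, and it is the set of all tuples that are reached from $a$ by repeatedly conjugating by elements of $S$ while staying inside $[p,q]$; (3) there is an algorithm that, given $r$, $p,q\in\mathbb{Z}^r$ and $a\in[p,q]$, lists the elements of $a^G\cap[p,q]$, each with an element of $G$ conjugating $a$ to it. -/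

import Mathlib

namespace GarsideSCP

section Monoid

variable {M : Type*} [Monoid M]

/-- The set of divisors of `b`: its left divisors (`a ∣ b`, that is, `b ∈ a M`) together with its
right divisors (`RightDvd a b`, that is, `b ∈ M a`). -/
def divisors (b : M) : Set M := {a | a ∣ b ∨ RightDvd a b}

/-- `b` is balanced: its left divisors are exactly its right divisors. -/
def IsBalanced (b : M) : Prop := {a : M | a ∣ b} = {a : M | RightDvd a b}

/-- `m` is a right lcm of `a` and `b`: a least common multiple for left divisibility. -/
def IsRightLcm (a b m : M) : Prop :=
  a ∣ m ∧ b ∣ m ∧ ∀ c : M, a ∣ c → b ∣ c → m ∣ c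

/-- `m` is a left lcm of `a` and `b`: a least common multiple for right divisibility. -/
def IsLeftLcm (a b m : M) : Prop :=
  RightDvd a m ∧ RightDvd b m ∧ ∀ c : M, RightDvd a c → RightDvd b c → RightDvd m c

/-- For each `a` there is `n` such that `a` is not a product of more than `n` nonidentity
elements. -/
def IsNoetherianMonoid (M : Type*) [Monoid M] : Prop :=
  ∀ a : M, ∃ n : ℕ, ∀ l : List M, (∀ x ∈ l, x ≠ 1) → l.prod = a → l.length ≤ n

/-- Gaussian monoids: Noetherian, cancellative, with right and left lcms of all pairs. -/
structure IsGaussian (M : Type*) [Monoid M] : Prop where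
  noetherian : IsNoetherianMonoid M
  cancel : IsCancelMul M
  exists_rightLcm : ∀ a b : M, ∃ m : M, IsRightLcm a b m
  exists_leftLcm : ∀ a b : M, ∃ m : M, IsLeftLcm a b m

end Monoid

section Group

variable {G : Type*} [Group G]

/-- `(G, S, Δ)` is a Garside group: `S` is finite, the monoid `G⁺` generated by `S` is Gaussian
and `G` is its group of fractions, `Δ ∈ G⁺` is balanced (as an element of `G⁺`), and `S` is the
set of divisors of `Δ` in `G⁺`. -/
structure IsGarside (S : Set G) (Δ : G) : Prop where
  finite_simples : S.Finite
  gaussian : IsGaussian (Submonoid.closure S)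
  fractions : ∀ x : G, ∃ a ∈ Submonoid.closure S, ∃ b ∈ Submonoid.closure S, x = a * b⁻¹
  garside_element : ∃ D : Submonoid.closure S,
    (D : G) = Δ ∧ IsBalanced D ∧ S = Subtype.val '' divisors D

/-- The order `a ≤ b` on `G`: there are `c, c' ∈ G⁺` with `b = c a c'`. -/
def GLe (S : Set G) (a b : G) : Prop :=
  ∃ c ∈ Submonoid.closure S, ∃ c' ∈ Submonoid.closure S, b = c * a * c'

/-- The interval `[p, q]` of `r`-tuples: the product of the intervals
`[p i, q i] = {x | Δ ^ p i ≤ x ≤ Δ ^ q i}`. Tuples of arbitrary length are lists, and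
membership requires that the tuple, `p` and `q` have the same length. -/
def box (S : Set G) (Δ : G) (p q : List ℤ) : Set (List G) :=
  {a | List.Forall₂ (fun (m : ℤ) (x : G) => GLe S (Δ ^ m) x) p a ∧
       List.Forall₂ (fun (x : G) (m : ℤ) => GLe S x (Δ ^ m)) a q}

/-- `(a₁, …, aᵣ) ^ x = (x⁻¹ a₁ x, …, x⁻¹ aᵣ x)`. -/
def conjTuple (a : List G) (x : G) : List G := a.map fun y => x⁻¹ * y * x

/-- The simultaneous conjugacy class of a tuple. -/
def conjClass (a : List G) : Set (List G) := {c | ∃ x : G, conjTuple a x = c}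

/-- One step of the method: conjugate by a simple element, staying in `[p, q]`. -/
def SimpleStep (S : Set G) (Δ : G) (p q : List ℤ) (u v : List G) : Prop :=
  (∃ s ∈ S, conjTuple u s = v) ∧ v ∈ box S Δ p q

end Group

/-- Words in `n` generators and their formal inverses: `(i, true)` stands for the `i`-th
generator and `(i, false)` for its inverse. -/
abbrev GWord (n : ℕ) : Type := List (Fin n × Bool)

section Words

variable {G : Type*} [Group G] {n : ℕ}

/-- The element of `G` represented by a word in the generators `g` and their inverses. -/
def evalWord (g : Fin n → G) (w : GWord n) : G :=
  (w.map fun x => cond x.2 (g x.1) (g x.1)⁻¹).prod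

/-- The tuple of elements of `G` represented by a tuple of words. -/
def evalTuple (g : Fin n → G) (u : List (GWord n)) : List G := u.map (evalWord g)

/-- The decision SCP is solvable: there is an algorithm that, given two tuples of words of
arbitrary length, decides whether the tuples they represent are simultaneously conjugate. -/
def DecisionSCPSolvable (g : Fin n → G) : Prop :=
  ComputablePred fun t : List (GWord n) × List (GWord n) =>
    evalTuple g t.2 ∈ conjClass (evalTuple g t.1)

/-- The search SCP is solvable: there is an algorithm that, given two tuples of words, returns
a word for a conjugating element if the tuples represented are conjugate, and reports failure
otherwise. -/
def SearchSCPSolvable (g : Fin n → G) : Prop :=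
  ∃ f : List (GWord n) × List (GWord n) → Option (GWord n), Computable f ∧
    ∀ u v : List (GWord n),
      (∀ w : GWord n, f (u, v) = some w →
        conjTuple (evalTuple g u) (evalWord g w) = evalTuple g v) ∧
      (f (u, v) = none → evalTuple g v ∉ conjClass (evalTuple g u))

/-- There is an algorithm that, given two tuples of words of the same length, finds an
interval `[p, q]` containing both of the tuples represented. -/
def BoxComputable (S : Set G) (Δ : G) (g : Fin n → G) : Prop :=
  ∃ f : List (GWord n) × List (GWord n) → List ℤ × List ℤ, Computable f ∧
    ∀ u v : List (GWord n), u.length = v.length →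
      evalTuple g u ∈ box S Δ (f (u, v)).1 (f (u, v)).2 ∧
      evalTuple g v ∈ box S Δ (f (u, v)).1 (f (u, v)).2

/-- There is an algorithm that, given words for a tuple `a` and given `p, q` with `a ∈ [p, q]`,
lists the set `a ^ G ∩ [p, q]`, each of its members accompanied by a conjugating element. -/
def ClassInBoxComputable (S : Set G) (Δ : G) (g : Fin n → G) : Prop :=
  ∃ f : List (GWord n) × (List ℤ × List ℤ) → List (List (GWord n) × GWord n), Computable f ∧
    ∀ (u : List (GWord n)) (p q : List ℤ), evalTuple g u ∈ box S Δ p q →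
      {c | ∃ t ∈ f (u, (p, q)), evalTuple g t.1 = c} =
        conjClass (evalTuple g u) ∩ box S Δ p q ∧
      ∀ t ∈ f (u, (p, q)), conjTuple (evalTuple g u) (evalWord g t.2) = evalTuple g t.1

end Words

end GarsideSCP

/-! Everything rests on a convexity property. Conjugation by Δ permutes the finite set S, so powers
of Δ normalise G⁺ and some positive power of Δ is central. Multiplying a conjugator by a high
central power of Δ makes it positive without changing the conjugate. Let x be positive with `a` and
its conjugate by x both in a box, and let h be the head of x, its greatest simple left divisor. Then
the conjugate of `a` by h is in the box as well (`posDvd_mul_isHead`, `posDvd_conj_isHead`).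
Noetherian induction, passing from x to h⁻¹x, yields a chain of simple conjugations inside the box
(`reflTransGen_of_pos`). Boxes are finite because translation by Δ^(-p) sends the interval from Δ^p
to Δ^q into the left divisors of Δ^(q-p), and a positive element has finitely many of these
(`finite_posDvd`).

For the algorithms, products of simple elements have greedy normal forms, computed from a finite
table and unique once the length is fixed. They decide equality and divisibility by Δ^j in G⁺, and
central powers of Δ carry both decisions over to G. A complete list of the class inside a box is
then recognised by a decidable certificate (`IsClassList`): it contains `a`, its entries are
conjugates of `a` in the box, and it is closed under simple steps. Finiteness provides such a list,
so an unbounded search finds one; connectedness makes it complete. To decide conjugacy, both tuples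
are enclosed in one box and the second is looked up in the list of the first. -/

namespace GarsideSCP

/-! ### Divisibility, heads and powers of Δ in a Garside group. -/

section Algebra

variable {G : Type*} [Group G] {S : Set G} {Δ : G}

/-- Left divisibility in `G` with respect to the monoid generated by `S`. -/
def PosDvd (S : Set G) (x y : G) : Prop := x⁻¹ * y ∈ Submonoid.closure S

theorem PosDvd.refl (x : G) : PosDvd S x x := by
  simp [PosDvd, one_mem]

theorem PosDvd.trans {x y z : G} (h : PosDvd S x y) (h' : PosDvd S y z) : PosDvd S x z := by
  have := mul_mem h h'
  rwa [show x⁻¹ * y * (y⁻¹ * z) = x⁻¹ * z by group] at this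

theorem posDvd_mul_left_iff {b x y : G} : PosDvd S (b * x) (b * y) ↔ PosDvd S x y := by
  unfold PosDvd
  rw [show (b * x)⁻¹ * (b * y) = x⁻¹ * y by group]

theorem posDvd_mul_right {x y : G} (h : y ∈ Submonoid.closure S) : PosDvd S x (x * y) := by
  unfold PosDvd
  rwa [show x⁻¹ * (x * y) = y by group]

theorem one_posDvd_iff {x : G} : PosDvd S 1 x ↔ x ∈ Submonoid.closure S := by
  simp [PosDvd]

theorem PosDvd.mem {x y : G} (h : PosDvd S x y) (hx : x ∈ Submonoid.closure S) :
    y ∈ Submonoid.closure S := by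
  have := mul_mem hx h
  rwa [show x * (x⁻¹ * y) = y by group] at this

/-- `h` is the greatest simple left divisor of `x`. -/
def IsHead (S : Set G) (x h : G) : Prop :=
  h ∈ S ∧ PosDvd S h x ∧ ∀ s ∈ S, PosDvd S s x → PosDvd S s h

namespace IsGarside

theorem mem_simples_iff_left (hG : IsGarside S Δ) {s : G} :
    s ∈ S ↔ s ∈ Submonoid.closure S ∧ PosDvd S s Δ := by
  obtain ⟨D, rfl, hb, hS⟩ := hG.garside_element
  constructor
  · intro hs
    refine ⟨Submonoid.subset_closure hs, ?_⟩
    rw [hS] at hs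
    obtain ⟨t, ht, rfl⟩ := hs
    have ht' : t ∣ D := ht.elim id fun h => by
      have : t ∈ {a | RightDvd a D} := h
      rwa [← hb] at this
    obtain ⟨c, rfl⟩ := ht'
    exact posDvd_mul_right c.2
  · rintro ⟨hs, hd⟩
    rw [hS]
    exact ⟨⟨s, hs⟩, Or.inl ⟨⟨_, hd⟩, Subtype.ext (by simp)⟩, rfl⟩

theorem mem_simples_iff_right (hG : IsGarside S Δ) {s : G} :
    s ∈ S ↔ s ∈ Submonoid.closure S ∧ Δ * s⁻¹ ∈ Submonoid.closure S := by
  obtain ⟨D, rfl, hb, hS⟩ := hG.garside_element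
  constructor
  · intro hs
    refine ⟨Submonoid.subset_closure hs, ?_⟩
    rw [hS] at hs
    obtain ⟨t, ht, rfl⟩ := hs
    have ht' : RightDvd t D := ht.elim (fun h => by
      have : t ∈ {a | a ∣ D} := h
      rwa [hb] at this) id
    obtain ⟨c, rfl⟩ := ht'
    simp
  · rintro ⟨hs, hd⟩
    rw [hS]
    exact ⟨⟨s, hs⟩, Or.inr ⟨⟨_, hd⟩, Subtype.ext (by simp)⟩, rfl⟩

theorem one_mem_simples (hG : IsGarside S Δ) : (1 : G) ∈ S := by
  obtain ⟨D, rfl, -⟩ := hG.garside_element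
  exact hG.mem_simples_iff_left.2 ⟨one_mem _, one_posDvd_iff.2 D.2⟩

theorem delta_mem_simples (hG : IsGarside S Δ) : Δ ∈ S := by
  refine hG.mem_simples_iff_left.2 ⟨?_, PosDvd.refl _⟩
  obtain ⟨D, rfl, -⟩ := hG.garside_element
  exact D.2

theorem delta_mem (hG : IsGarside S Δ) : Δ ∈ Submonoid.closure S :=
  Submonoid.subset_closure hG.delta_mem_simples

theorem exists_lcm (hG : IsGarside S Δ) {a b : G} (ha : a ∈ Submonoid.closure S)
    (hb : b ∈ Submonoid.closure S) :
    ∃ m, PosDvd S a m ∧ PosDvd S b m ∧ ∀ c, PosDvd S a c → PosDvd S b c → PosDvd S m c := by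
  obtain ⟨m, ⟨u, hu⟩, ⟨v, hv⟩, h⟩ := hG.gaussian.exists_rightLcm ⟨a, ha⟩ ⟨b, hb⟩
  refine ⟨m, ?_, ?_, fun c hac hbc => ?_⟩
  · rw [hu]; exact posDvd_mul_right u.2
  · rw [hv]; exact posDvd_mul_right v.2
  · obtain ⟨w, hw⟩ := h ⟨c, hac.mem ha⟩ ⟨⟨_, hac⟩, Subtype.ext (by simp)⟩
      ⟨⟨_, hbc⟩, Subtype.ext (by simp)⟩
    have : c = m * w := congrArg Subtype.val hw
    rw [this]
    exact posDvd_mul_right w.2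

/-- Well-founded induction along proper right factors in the positive monoid. -/
theorem pos_induction (hG : IsGarside S Δ) {motive : G → Prop}
    (step : ∀ x ∈ Submonoid.closure S, (∀ s ∈ Submonoid.closure S, s ≠ 1 →
      ∀ y ∈ Submonoid.closure S, x = s * y → motive y) → motive x)
    {x : G} (hx : x ∈ Submonoid.closure S) : motive x := by
  have key : ∀ n : ℕ, ∀ x : Submonoid.closure S,
      (∀ l : List (Submonoid.closure S), (∀ y ∈ l, y ≠ 1) → l.prod = x → l.length ≤ n) →
      motive x := by
    intro n
    induction n with
    | zero =>
      intro x hb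
      refine step x x.2 fun s hs hs1 y hy hxy => absurd ?_ (Nat.not_succ_le_zero 0)
      have hs1' : (⟨s, hs⟩ : Submonoid.closure S) ≠ 1 := fun h => hs1 (congrArg Subtype.val h)
      -- The bound counts nonidentity factors only, so y must be left out when it is 1.
      by_cases hy1 : y = 1
      · exact hb [⟨s, hs⟩] (by simpa using hs1') (Subtype.ext (by simp [hxy, hy1]))
      · have hy1' : (⟨y, hy⟩ : Submonoid.closure S) ≠ 1 := fun h => hy1 (congrArg Subtype.val h)
        have := hb [⟨s, hs⟩, ⟨y, hy⟩] (List.forall_mem_cons.2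
          ⟨hs1', List.forall_mem_singleton.2 hy1'⟩) (Subtype.ext (by simp [hxy]))
        simp at this
    | succ n ih =>
      intro x hb
      refine step x x.2 fun s hs hs1 y hy hxy => ih ⟨y, hy⟩ fun l hl hly => ?_
      have hs1' : (⟨s, hs⟩ : Submonoid.closure S) ≠ 1 := fun h => hs1 (congrArg Subtype.val h)
      have := hb (⟨s, hs⟩ :: l) (List.forall_mem_cons.2 ⟨hs1', hl⟩)
        (Subtype.ext (by rw [List.prod_cons, hly, hxy]; rfl))
      simpa using this
  obtain ⟨n, hn⟩ := hG.gaussian.noetherian ⟨x, hx⟩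
  exact key n ⟨x, hx⟩ hn

/-- A unit u ≠ 1 could be split off any unit x as x = u(u⁻¹x), leaving another unit: an infinite
descent, against Noetherianity. -/
theorem eq_one_of_inv_mem (hG : IsGarside S Δ) {u : G} (hu : u ∈ Submonoid.closure S)
    (hu' : u⁻¹ ∈ Submonoid.closure S) : u = 1 := by
  by_contra h1
  refine hG.pos_induction (motive := fun x => x⁻¹ ∉ Submonoid.closure S)
    (fun x hx ih hx' => ?_) hu hu'
  exact ih u hu h1 (u⁻¹ * x) (mul_mem hu' hx) (by group) (by
    rw [mul_inv_rev, inv_inv]; exact mul_mem hx' hu)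

theorem posDvd_antisymm (hG : IsGarside S Δ) {x y : G} (h : PosDvd S x y) (h' : PosDvd S y x) :
    x = y := by
  have := hG.eq_one_of_inv_mem h (by rwa [mul_inv_rev, inv_inv])
  rwa [inv_mul_eq_one] at this

/-- The head is the lcm of the finitely many simple left divisors of x. It is simple because all of
them divide Δ, and it divides x because all of them do. -/
theorem exists_isHead (hG : IsGarside S Δ) {x : G} (hx : x ∈ Submonoid.closure S) :
    ∃ h, IsHead S x h := by
  have key : ∀ T : Set G, T.Finite → T ⊆ {s | s ∈ S ∧ PosDvd S s x} →
      ∃ h ∈ S, PosDvd S h x ∧ ∀ s ∈ T, PosDvd S s h := by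
    intro T hT
    induction T, hT using Set.Finite.induction_on with
    | empty => exact fun _ => ⟨1, hG.one_mem_simples, one_posDvd_iff.2 hx, by simp⟩
    | @insert t T _ _ ih =>
      intro hsub
      obtain ⟨h, hS, hhx, hh⟩ := ih ((Set.subset_insert _ _).trans hsub)
      obtain ⟨ht, htx⟩ := hsub (Set.mem_insert _ _)
      obtain ⟨m, htm, hhm, hm⟩ := hG.exists_lcm (Submonoid.subset_closure ht)
        (Submonoid.subset_closure hS)
      refine ⟨m, hG.mem_simples_iff_left.2 ⟨htm.mem (Submonoid.subset_closure ht), ?_⟩,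
        hm _ htx hhx, ?_⟩
      · exact hm _ (hG.mem_simples_iff_left.1 ht).2 (hG.mem_simples_iff_left.1 hS).2
      · rintro s (rfl | hs)
        · exact htm
        · exact (hh s hs).trans hhm
  obtain ⟨h, hS, hhx, hh⟩ := key {s | s ∈ S ∧ PosDvd S s x}
    (hG.finite_simples.subset fun _ h => h.1) subset_rfl
  exact ⟨h, hS, hhx, fun s hs hsx => hh s ⟨hs, hsx⟩⟩

theorem isHead_unique (hG : IsGarside S Δ) {x h k : G} (hh : IsHead S x h) (hk : IsHead S x k) :
    h = k :=
  hG.posDvd_antisymm (hk.2.2 _ hh.1 hh.2.1) (hh.2.2 _ hk.1 hk.2.1)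

theorem exists_simple_ne_one_posDvd {x : G} (hx : x ∈ Submonoid.closure S) (h1 : x ≠ 1) :
    ∃ s ∈ S, s ≠ 1 ∧ PosDvd S s x := by
  induction hx using Submonoid.closure_induction with
  | mem x hx => exact ⟨x, hx, h1, PosDvd.refl x⟩
  | one => exact absurd rfl h1
  | mul x y hx hy ihx ihy =>
    by_cases hx1 : x = 1
    · subst hx1
      rw [one_mul] at h1 ⊢
      exact ihy h1
    · obtain ⟨s, hs, hs1, hd⟩ := ihx hx1
      exact ⟨s, hs, hs1, hd.trans (posDvd_mul_right hy)⟩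

theorem isHead_ne_one (hG : IsGarside S Δ) {x h : G} (hx : x ∈ Submonoid.closure S)
    (hh : IsHead S x h) (h1 : x ≠ 1) : h ≠ 1 := by
  rintro rfl
  obtain ⟨s, hs, hs1, hd⟩ := exists_simple_ne_one_posDvd hx h1
  have := hh.2.2 s hs hd
  exact hs1 (hG.eq_one_of_inv_mem (Submonoid.subset_closure hs) (by simpa [PosDvd] using this))

/-- The complement s ↦ s⁻¹Δ maps S to S because Δ is balanced, and its square is conjugation by Δ.
-/
theorem conj_delta_simples (hG : IsGarside S Δ) {s : G} (hs : s ∈ S) : Δ⁻¹ * s * Δ ∈ S := by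
  have key : ∀ {s : G}, s ∈ S → s⁻¹ * Δ ∈ S := fun {s} hs =>
    hG.mem_simples_iff_right.2 ⟨(hG.mem_simples_iff_left.1 hs).2, by
      rw [show Δ * (s⁻¹ * Δ)⁻¹ = s by group]; exact Submonoid.subset_closure hs⟩
  have := key (key hs)
  rwa [show (s⁻¹ * Δ)⁻¹ * Δ = Δ⁻¹ * s * Δ by group] at this

theorem conj_delta_inv_simples (hG : IsGarside S Δ) {s : G} (hs : s ∈ S) : Δ * s * Δ⁻¹ ∈ S := by
  have key : ∀ {s : G}, s ∈ S → Δ * s⁻¹ ∈ S := fun {s} hs =>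
    hG.mem_simples_iff_left.2 ⟨(hG.mem_simples_iff_right.1 hs).2, by
      unfold PosDvd
      rw [show (Δ * s⁻¹)⁻¹ * Δ = s by group]; exact Submonoid.subset_closure hs⟩
  have := key (key hs)
  rwa [show Δ * (Δ * s⁻¹)⁻¹ = Δ * s * Δ⁻¹ by group] at this

theorem conj_pow_simples (hG : IsGarside S Δ) (m : ℤ) {s : G} (hs : s ∈ S) :
    (Δ ^ m)⁻¹ * s * Δ ^ m ∈ S := by
  induction m using Int.induction_on with
  | zero => simpa using hs
  | succ k ih =>
    have := hG.conj_delta_simples ih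
    rwa [show Δ⁻¹ * ((Δ ^ (k : ℤ))⁻¹ * s * Δ ^ (k : ℤ)) * Δ =
      (Δ ^ ((k : ℤ) + 1))⁻¹ * s * Δ ^ ((k : ℤ) + 1) by group] at this
  | pred k ih =>
    have := hG.conj_delta_inv_simples ih
    rwa [show Δ * ((Δ ^ (-k : ℤ))⁻¹ * s * Δ ^ (-k : ℤ)) * Δ⁻¹ =
      (Δ ^ (-(k : ℤ) - 1))⁻¹ * s * Δ ^ (-(k : ℤ) - 1) by group] at this

theorem conj_pow_mem (hG : IsGarside S Δ) (m : ℤ) {x : G} (hx : x ∈ Submonoid.closure S) :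
    (Δ ^ m)⁻¹ * x * Δ ^ m ∈ Submonoid.closure S := by
  induction hx using Submonoid.closure_induction with
  | mem x hx => exact Submonoid.subset_closure (hG.conj_pow_simples m hx)
  | one => simp [one_mem]
  | mul x y hx hy ihx ihy =>
    have := mul_mem ihx ihy
    rwa [show (Δ ^ m)⁻¹ * x * Δ ^ m * ((Δ ^ m)⁻¹ * y * Δ ^ m) =
      (Δ ^ m)⁻¹ * (x * y) * Δ ^ m by group] at this

theorem conj_pow_mem_iff (hG : IsGarside S Δ) (m : ℤ) {x : G} :
    (Δ ^ m)⁻¹ * x * Δ ^ m ∈ Submonoid.closure S ↔ x ∈ Submonoid.closure S := by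
  refine ⟨fun h => ?_, hG.conj_pow_mem m⟩
  have := hG.conj_pow_mem (-m) h
  rwa [show (Δ ^ (-m))⁻¹ * ((Δ ^ m)⁻¹ * x * Δ ^ m) * Δ ^ (-m) = x by
    rw [zpow_neg]; group] at this

theorem posDvd_pow_iff (hG : IsGarside S Δ) (m : ℤ) {x : G} :
    PosDvd S (Δ ^ m) x ↔ x * (Δ ^ m)⁻¹ ∈ Submonoid.closure S := by
  rw [← hG.conj_pow_mem_iff m (x := x * _)]
  unfold PosDvd
  rw [show (Δ ^ m)⁻¹ * (x * (Δ ^ m)⁻¹) * Δ ^ m = (Δ ^ m)⁻¹ * x by group]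

/-- Since Δ^m normalises G⁺, the left factor in the definition of `GLe` can be moved to the right.
-/
theorem pow_gLe_iff (hG : IsGarside S Δ) (m : ℤ) {x : G} :
    GLe S (Δ ^ m) x ↔ PosDvd S (Δ ^ m) x := by
  constructor
  · rintro ⟨c, hc, d, hd, rfl⟩
    have := mul_mem (hG.conj_pow_mem m hc) hd
    unfold PosDvd
    rwa [show (Δ ^ m)⁻¹ * c * Δ ^ m * d = (Δ ^ m)⁻¹ * (c * Δ ^ m * d) by group] at this
  · intro h
    exact ⟨1, one_mem _, _, h, by group⟩

/-- Inversion turns upper bounds into lower bounds, so only lower bounds need an argument later. -/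
theorem gLe_pow_iff (hG : IsGarside S Δ) (m : ℤ) {x : G} :
    GLe S x (Δ ^ m) ↔ PosDvd S (Δ ^ (-m)) x⁻¹ := by
  rw [← hG.pow_gLe_iff]
  constructor
  · rintro ⟨c, hc, d, hd, h⟩
    refine ⟨d, hd, c, hc, ?_⟩
    rw [zpow_neg, h]; group
  · rintro ⟨c, hc, d, hd, h⟩
    refine ⟨d, hd, c, hc, ?_⟩
    rw [zpow_neg] at h
    rw [← inv_inv x, h]; group

theorem posDvd_delta_mul (hG : IsGarside S Δ) {b : G} (hb : b ∈ Submonoid.closure S) :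
    PosDvd S Δ (b * Δ) := by
  have := hG.conj_pow_mem 1 hb
  unfold PosDvd
  rwa [zpow_one, mul_assoc] at this

/-- Write the lcm of y and b as bt. Both y and b divide bx and bΔ, so t divides x and Δ. Thus t is a
simple left divisor of x, hence divides h, and y divides bt, which divides bh. -/
theorem posDvd_mul_isHead (hG : IsGarside S Δ) {b x y h : G} (hb : b ∈ Submonoid.closure S)
    (hx : x ∈ Submonoid.closure S) (hy : y ∈ Submonoid.closure S) (hh : IsHead S x h)
    (hyx : PosDvd S y (b * x)) (hyd : PosDvd S y Δ) : PosDvd S y (b * h) := by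
  obtain ⟨m, hym, hbm, hm⟩ := hG.exists_lcm hy hb
  have h1 := hm _ hyx (posDvd_mul_right hx)
  have h2 := hm _ (hyd.trans (hG.posDvd_delta_mul hb)) (posDvd_mul_right hG.delta_mem)
  rw [show m = b * (b⁻¹ * m) by group, posDvd_mul_left_iff] at h1 h2
  have := hh.2.2 _ (hG.mem_simples_iff_left.2 ⟨hbm, h2⟩) h1
  rw [← posDvd_mul_left_iff (b := b), mul_inv_cancel_left] at this
  exact hym.trans this

theorem isHead_mul (hG : IsGarside S Δ) {b x h k : G} (hb : b ∈ Submonoid.closure S)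
    (hx : x ∈ Submonoid.closure S) (hh : IsHead S x h) (hk : IsHead S (b * h) k) :
    IsHead S (b * x) k :=
  ⟨hk.1, hk.2.1.trans (posDvd_mul_left_iff.2 hh.2.1), fun s hs hsx => hk.2.2 s hs <|
    hG.posDvd_mul_isHead hb hx (Submonoid.subset_closure hs) hh hsx
      (hG.mem_simples_iff_left.1 hs).2⟩

/-- The convexity step. With b = Δ^(-m)a positive and τ denoting conjugation by Δ^m, the hypothesis
on x⁻¹ax says that τ(x) divides bx. So the simple element τ(h) divides bx, hence bh by
`posDvd_mul_isHead`, which is the claim for h. -/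
theorem posDvd_conj_isHead (hG : IsGarside S Δ) (m : ℤ) {a x h : G}
    (hx : x ∈ Submonoid.closure S) (hh : IsHead S x h) (ha : PosDvd S (Δ ^ m) a)
    (hax : PosDvd S (Δ ^ m) (x⁻¹ * a * x)) : PosDvd S (Δ ^ m) (h⁻¹ * a * h) := by
  have hh' := hG.conj_pow_simples m hh.1
  have h1 : PosDvd S ((Δ ^ m)⁻¹ * h * Δ ^ m) ((Δ ^ m)⁻¹ * a * x) := by
    have := mul_mem (hG.conj_pow_mem m hh.2.1) hax
    unfold PosDvd
    rwa [show (Δ ^ m)⁻¹ * (h⁻¹ * x) * Δ ^ m * ((Δ ^ m)⁻¹ * (x⁻¹ * a * x)) =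
      ((Δ ^ m)⁻¹ * h * Δ ^ m)⁻¹ * ((Δ ^ m)⁻¹ * a * x) by group] at this
  have := hG.posDvd_mul_isHead ha hx (Submonoid.subset_closure hh') hh h1
    (hG.mem_simples_iff_left.1 hh').2
  unfold PosDvd at this ⊢
  rwa [show ((Δ ^ m)⁻¹ * h * Δ ^ m)⁻¹ * ((Δ ^ m)⁻¹ * a * h) =
    (Δ ^ m)⁻¹ * (h⁻¹ * a * h) by group] at this

theorem exists_posDvd_pow (hG : IsGarside S Δ) {x : G} (hx : x ∈ Submonoid.closure S) :
    ∃ k : ℕ, PosDvd S x (Δ ^ k) := by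
  induction hx using Submonoid.closure_induction with
  | mem x hx => exact ⟨1, by simpa using (hG.mem_simples_iff_left.1 hx).2⟩
  | one => exact ⟨0, by simpa using PosDvd.refl 1⟩
  | mul x y hx hy ihx ihy =>
    obtain ⟨k, hk⟩ := ihx
    obtain ⟨l, hl⟩ := ihy
    refine ⟨k + l, ?_⟩
    have := mul_mem hl (hG.conj_pow_mem l hk)
    unfold PosDvd
    rw [zpow_natCast] at this
    rwa [pow_add, show (x * y)⁻¹ * (Δ ^ k * Δ ^ l) =
      y⁻¹ * Δ ^ l * ((Δ ^ l)⁻¹ * (x⁻¹ * Δ ^ k) * Δ ^ l) by group]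

theorem posDvd_pow_mono (hG : IsGarside S Δ) {x : G} {k l : ℕ} (hkl : k ≤ l)
    (h : PosDvd S x (Δ ^ k)) : PosDvd S x (Δ ^ l) := by
  obtain ⟨j, rfl⟩ := Nat.exists_eq_add_of_le hkl
  rw [pow_add]
  exact h.trans (posDvd_mul_right (pow_mem hG.delta_mem j))

/-- Some positive power of `Δ` is central. -/
theorem exists_pow_central (hG : IsGarside S Δ) :
    ∃ N : ℕ, 0 < N ∧ ∀ x : G, Commute (Δ ^ N) x := by
  have h1 : ∀ s ∈ S, ∃ k : ℕ, 0 < k ∧ Commute (Δ ^ k) s := by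
    intro s hs
    obtain ⟨i, j, hij, h⟩ := Set.Finite.exists_lt_map_eq_of_forall_mem (t := S)
      (f := fun k : ℕ => (Δ ^ (k : ℤ))⁻¹ * s * Δ ^ (k : ℤ))
      (fun k => hG.conj_pow_simples k hs) hG.finite_simples
    obtain ⟨k, rfl⟩ := Nat.exists_eq_add_of_lt hij
    refine ⟨k + 1, k.succ_pos, ?_⟩
    simp only [zpow_natCast] at h
    rw [add_assoc, pow_add] at h
    -- Two conjugates of s by different powers of Δ coincide by pigeonhole; undoing the smaller
    -- power shows that the difference of the exponents gives a power commuting with s.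
    have h2 := congrArg (fun t => Δ ^ (k + 1) * (Δ ^ i * t * (Δ ^ i)⁻¹)) h
    have e1 : Δ ^ (k + 1) * (Δ ^ i * ((Δ ^ i)⁻¹ * s * Δ ^ i) * (Δ ^ i)⁻¹) = Δ ^ (k + 1) * s := by
      group
    have e2 : Δ ^ (k + 1) * (Δ ^ i * ((Δ ^ i * Δ ^ (k + 1))⁻¹ * s * (Δ ^ i * Δ ^ (k + 1))) *
        (Δ ^ i)⁻¹) = s * Δ ^ (k + 1) := by
      rw [(Commute.pow_pow_self Δ i (k + 1)).eq]; group
    rw [e1, e2] at h2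
    exact h2
  have h2 : ∀ T : Set G, T.Finite → T ⊆ S → ∃ k : ℕ, 0 < k ∧ ∀ s ∈ T, Commute (Δ ^ k) s := by
    intro T hT
    induction T, hT using Set.Finite.induction_on with
    | empty => exact fun _ => ⟨1, one_pos, by simp⟩
    | @insert t T _ _ ih =>
      intro hsub
      obtain ⟨k, hk, h⟩ := ih ((Set.subset_insert _ _).trans hsub)
      obtain ⟨l, hl, h'⟩ := h1 t (hsub (Set.mem_insert _ _))
      refine ⟨k * l, Nat.mul_pos hk hl, ?_⟩
      rintro s (rfl | hs)
      · rw [mul_comm, pow_mul]; exact h'.pow_left k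
      · rw [pow_mul]; exact (h s hs).pow_left l
  obtain ⟨N, hN, h⟩ := h2 S hG.finite_simples subset_rfl
  have h3 : ∀ x ∈ Submonoid.closure S, Commute (Δ ^ N) x := fun x hx => by
    induction hx using Submonoid.closure_induction with
    | mem x hx => exact h x hx
    | one => exact Commute.one_right _
    | mul x y _ _ ihx ihy => exact ihx.mul_right ihy
  refine ⟨N, hN, fun x => ?_⟩
  obtain ⟨a, ha, b, hb, rfl⟩ := hG.fractions x
  exact (h3 a ha).mul_right (h3 b hb).inv_right

/-- A divisor m ≠ 1 of y is sm' with s ≠ 1 simple and m' a divisor of s⁻¹y. There are finitely many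
s, and Noetherian induction applies to s⁻¹y. -/
theorem finite_posDvd (hG : IsGarside S Δ) {y : G} (hy : y ∈ Submonoid.closure S) :
    {m : G | m ∈ Submonoid.closure S ∧ PosDvd S m y}.Finite := by
  refine hG.pos_induction (motive := fun y =>
    {m : G | m ∈ Submonoid.closure S ∧ PosDvd S m y}.Finite) (fun y hy ih => ?_) hy
  have hfin : {s : G | s ∈ S ∧ s ≠ 1 ∧ PosDvd S s y}.Finite :=
    hG.finite_simples.subset fun _ h => h.1
  refine ((Set.finite_singleton (1 : G)).union (hfin.biUnion (t := fun s =>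
    (fun m => s * m) '' {m : G | m ∈ Submonoid.closure S ∧ PosDvd S m (s⁻¹ * y)})
    fun s hs => Set.Finite.image _ ?_)).subset ?_
  · exact ih s (Submonoid.subset_closure hs.1) hs.2.1 _ hs.2.2 (by group)
  · rintro m ⟨hm, hmy⟩
    by_cases h1 : m = 1
    · exact Or.inl h1
    · obtain ⟨s, hs, hs1, hsm⟩ := exists_simple_ne_one_posDvd hm h1
      refine Or.inr (Set.mem_biUnion (x := s) ⟨hs, hs1, hsm.trans hmy⟩
        ⟨s⁻¹ * m, ⟨hsm, posDvd_mul_left_iff.2 hmy⟩, by group⟩)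

theorem finite_interval (hG : IsGarside S Δ) (p q : ℤ) :
    {x : G | GLe S (Δ ^ p) x ∧ GLe S x (Δ ^ q)}.Finite := by
  have hle : ∀ x : G, GLe S (Δ ^ p) x → GLe S x (Δ ^ q) →
      PosDvd S ((Δ ^ p)⁻¹ * x) ((Δ ^ p)⁻¹ * Δ ^ q) := by
    intro x _ h2
    rw [hG.gLe_pow_iff, hG.posDvd_pow_iff, zpow_neg, inv_inv] at h2
    exact posDvd_mul_left_iff.2 h2
  by_cases hpq : (Δ ^ p)⁻¹ * Δ ^ q ∈ Submonoid.closure S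
  · refine ((hG.finite_posDvd hpq).image fun m => Δ ^ p * m).subset ?_
    rintro x ⟨h1, h2⟩
    exact ⟨(Δ ^ p)⁻¹ * x, ⟨(hG.pow_gLe_iff p).1 h1, hle x h1 h2⟩, by group⟩
  · convert Set.finite_empty
    refine Set.eq_empty_of_forall_notMem fun x ⟨h1, h2⟩ => hpq ?_
    exact (hle x h1 h2).mem ((hG.pow_gLe_iff p).1 h1)

theorem finite_box (hG : IsGarside S Δ) (p q : List ℤ) : (box S Δ p q).Finite := by
  induction p generalizing q with
  | nil =>
    refine (Set.finite_singleton ([] : List G)).subset ?_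
    rintro a ⟨h, -⟩
    exact List.forall₂_nil_left_iff.1 h
  | cons m p ih =>
    cases q with
    | nil =>
      convert Set.finite_empty
      refine Set.eq_empty_of_forall_notMem ?_
      rintro a ⟨h, h'⟩
      cases h'
      cases h
    | cons k q =>
      refine ((hG.finite_interval m k).image2 List.cons (ih q)).subset ?_
      rintro a ⟨h, h'⟩
      cases h with
      | cons h1 h2 =>
        cases h' with
        | cons h1' h2' => exact ⟨_, ⟨h1, h1'⟩, _, ⟨h2, h2'⟩, rfl⟩

end IsGarside

/-! ### Conjugation of tuples and connectedness inside a box. -/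

theorem conjTuple_one (a : List G) : conjTuple a 1 = a := by
  simp [conjTuple]

theorem conjTuple_mul (a : List G) (x y : G) :
    conjTuple a (x * y) = conjTuple (conjTuple a x) y := by
  simp [conjTuple, mul_assoc]

theorem mem_box_of_forall {p q : List ℤ} {a : List G} {f g : G → G} (ha : a ∈ box S Δ p q)
    (hf : a.map f ∈ box S Δ p q)
    (h1 : ∀ (m : ℤ) (x : G), GLe S (Δ ^ m) x → GLe S (Δ ^ m) (f x) → GLe S (Δ ^ m) (g x))
    (h2 : ∀ (m : ℤ) (x : G), GLe S x (Δ ^ m) → GLe S (f x) (Δ ^ m) → GLe S (g x) (Δ ^ m)) :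
    a.map g ∈ box S Δ p q := by
  obtain ⟨ha1, ha2⟩ := ha
  obtain ⟨hf1, hf2⟩ := hf
  constructor
  · clear ha2 hf2 h2
    induction ha1 with
    | nil => exact .nil
    | cons h _ ih =>
      cases hf1 with
      | cons h' t' => exact .cons (h1 _ _ h h') (ih t')
  · clear ha1 hf1 h1
    induction ha2 with
    | nil => exact .nil
    | cons h _ ih =>
      cases hf2 with
      | cons h' t' => exact .cons (h2 _ _ h h') (ih t')

namespace IsGarside

theorem conjTuple_isHead_mem_box (hG : IsGarside S Δ) {p q : List ℤ} {a : List G} {x h : G}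
    (hx : x ∈ Submonoid.closure S) (hh : IsHead S x h) (ha : a ∈ box S Δ p q)
    (hax : conjTuple a x ∈ box S Δ p q) : conjTuple a h ∈ box S Δ p q := by
  refine mem_box_of_forall ha hax (fun m y h1 h2 => ?_) fun m y h1 h2 => ?_
  · rw [hG.pow_gLe_iff] at *
    exact hG.posDvd_conj_isHead m hx hh h1 h2
  · rw [hG.gLe_pow_iff] at *
    have e : ∀ x : G, (x⁻¹ * y * x)⁻¹ = x⁻¹ * y⁻¹ * x := fun x => by group
    rw [e] at h2 ⊢
    exact hG.posDvd_conj_isHead _ hx hh h1 h2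

theorem reflTransGen_of_pos (hG : IsGarside S Δ) {p q : List ℤ} {x : G}
    (hx : x ∈ Submonoid.closure S) : ∀ a ∈ box S Δ p q, conjTuple a x ∈ box S Δ p q →
      Relation.ReflTransGen (SimpleStep S Δ p q) a (conjTuple a x) := by
  refine hG.pos_induction (motive := fun x => ∀ a ∈ box S Δ p q, conjTuple a x ∈ box S Δ p q →
      Relation.ReflTransGen (SimpleStep S Δ p q) a (conjTuple a x))
      (fun x hx ih a ha hax => ?_) hx
  by_cases h1 : x = 1
  · rw [h1, conjTuple_one]
  · obtain ⟨h, hh⟩ := hG.exists_isHead hx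
    have hb := hG.conjTuple_isHead_mem_box hx hh ha hax
    have e : x = h * (h⁻¹ * x) := by group
    rw [e, conjTuple_mul] at hax ⊢
    exact Relation.ReflTransGen.head ⟨⟨h, hh.1, rfl⟩, hb⟩
      (ih h (Submonoid.subset_closure hh.1) (hG.isHead_ne_one hx hh h1) _ hh.2.1 e _ hb hax)

theorem exists_pos_mul_central (hG : IsGarside S Δ) (x : G) :
    ∃ z : G, (∀ y, Commute z y) ∧ x * z ∈ Submonoid.closure S := by
  obtain ⟨N, hN, hc⟩ := hG.exists_pow_central
  obtain ⟨a, ha, b, hb, rfl⟩ := hG.fractions x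
  obtain ⟨k, hk⟩ := hG.exists_posDvd_pow hb
  refine ⟨Δ ^ (N * k), fun y => ?_, ?_⟩
  · rw [pow_mul]; exact (hc y).pow_left k
  · rw [mul_assoc]
    exact mul_mem ha (hG.posDvd_pow_mono (Nat.le_mul_of_pos_left k hN) hk)

/-- The intersection of a conjugacy class with a box is connected under conjugation by simple
elements. -/
theorem conjClass_inter_box (hG : IsGarside S Δ) {p q : List ℤ} {a : List G}
    (ha : a ∈ box S Δ p q) : conjClass a ∩ box S Δ p q =
      {c | Relation.ReflTransGen (SimpleStep S Δ p q) a c} := by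
  ext c
  constructor
  · rintro ⟨⟨x, rfl⟩, hc⟩
    obtain ⟨z, hz, hxz⟩ := hG.exists_pos_mul_central x
    have e : conjTuple a (x * z) = conjTuple a x := by
      refine List.map_congr_left fun y _ => ?_
      rw [mul_inv_rev, show z⁻¹ * x⁻¹ * y * (x * z) = z⁻¹ * ((x⁻¹ * y * x) * z) by group,
        ← (hz _).eq]
      group
    have := hG.reflTransGen_of_pos hxz a ha (by rwa [e])
    rwa [e] at this
  · intro h
    induction h with
    | refl => exact ⟨⟨1, conjTuple_one a⟩, ha⟩
    | tail _ hs ih =>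
      obtain ⟨⟨x, rfl⟩, -⟩ := ih
      obtain ⟨⟨s, -, rfl⟩, hb⟩ := hs
      exact ⟨⟨x * s, conjTuple_mul a x s⟩, hb⟩

end IsGarside

end Algebra

/-! ### Greedy normal forms in the positive monoid. -/

section NormalForm

variable {G : Type*} [Group G] {S : Set G} {Δ : G} {k : ℕ}

/-- The product of a list of indexed elements. -/
def spell (e : Fin k → G) (l : List (Fin k)) : G := (l.map e).prod

@[simp] theorem spell_nil (e : Fin k → G) : spell e [] = 1 := rfl

@[simp] theorem spell_cons (e : Fin k → G) (s : Fin k) (l : List (Fin k)) :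
    spell e (s :: l) = e s * spell e l := by simp [spell]

@[simp] theorem spell_append (e : Fin k → G) (l l' : List (Fin k)) :
    spell e (l ++ l') = spell e l * spell e l' := by simp [spell]

theorem spell_map_const {α : Type*} (e : Fin k → G) (d : Fin k) (l : List α) :
    spell e (l.map fun _ => d) = e d ^ l.length := by
  simp [spell]

/-- Each letter spells the greatest simple left divisor of the remaining product. Trailing
letters may spell `1`. -/
def IsNF (S : Set G) (e : Fin k → G) : List (Fin k) → Prop
  | [] => True
  | s :: l => IsHead S (e s * spell e l) (e s) ∧ IsNF S e l

/-- `f` refactors each product of two simple elements with its head in front. -/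
def IsHeadTable (S : Set G) (e : Fin k → G) (f : Fin k → Fin k → Fin k × Fin k) : Prop :=
  ∀ t s, e t * e s = e (f t s).1 * e (f t s).2 ∧ IsHead S (e t * e s) (e (f t s).1)

/-- Left multiplication of a normal form by a simple element. -/
def mulNF (f : Fin k → Fin k → Fin k × Fin k) : Fin k → List (Fin k) → List (Fin k)
  | t, [] => [t]
  | t, s :: l => (f t s).1 :: mulNF f (f t s).2 l

theorem mulNF_length (f : Fin k → Fin k → Fin k × Fin k) (t : Fin k) (l : List (Fin k)) :
    (mulNF f t l).length = l.length + 1 := by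
  induction l generalizing t with
  | nil => rfl
  | cons s l ih => simp [mulNF, ih]

/-- The parameter t changes along the recursion of `mulNF`; a left fold whose state is the output so
far and the carried letter puts it in a form suited to `Primrec.list_foldl`. -/
theorem foldl_eq_mulNF (f : Fin k → Fin k → Fin k × Fin k) (t : Fin k) (l acc : List (Fin k)) :
    (l.foldl (fun (p : List (Fin k) × Fin k) s => (p.1 ++ [(f p.2 s).1], (f p.2 s).2))
      (acc, t)).1 ++ [(l.foldl (fun (p : List (Fin k) × Fin k) s =>
        (p.1 ++ [(f p.2 s).1], (f p.2 s).2)) (acc, t)).2] = acc ++ mulNF f t l := by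
  induction l generalizing t acc with
  | nil => simp [mulNF]
  | cons s l ih => simp [mulNF, ih]

theorem primrec_mulNF (f : Fin k → Fin k → Fin k × Fin k) : Primrec₂ (mulNF f) := by
  have hf : Primrec₂ f := Primrec.dom_finite (Function.uncurry f)
  have hfold : Primrec₂ fun (t : Fin k) (l : List (Fin k)) =>
      l.foldl (fun (p : List (Fin k) × Fin k) s => (p.1 ++ [(f p.2 s).1], (f p.2 s).2)) ([], t) := by
    have hp : Primrec fun x : (Fin k × List (Fin k)) × ((List (Fin k) × Fin k) × Fin k) =>
        x.2.1 := Primrec.fst.comp Primrec.snd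
    have hv : Primrec fun x : (Fin k × List (Fin k)) × ((List (Fin k) × Fin k) × Fin k) =>
        f x.2.1.2 x.2.2 := hf.comp (Primrec.snd.comp hp) (Primrec.snd.comp Primrec.snd)
    refine Primrec.list_foldl (h := fun _ x => (x.1.1 ++ [(f x.1.2 x.2).1], (f x.1.2 x.2).2))
      Primrec.snd ((Primrec.const []).pair Primrec.fst) ?_
    exact (Primrec.list_concat.comp (Primrec.fst.comp hp) (Primrec.fst.comp hv)).pair
      (Primrec.snd.comp hv)
  refine (Primrec.list_concat.comp₂ (Primrec.fst.comp₂ hfold) (Primrec.snd.comp₂ hfold)).of_eq ?_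
  intro t l
  simpa using foldl_eq_mulNF f t l []

/-- The normal form of the product of `l`, padded to length `l.length + pad.length`. -/
def normalize (f : Fin k → Fin k → Fin k × Fin k) (one : Fin k) (l pad : List (Fin k)) :
    List (Fin k) :=
  l.foldr (mulNF f) (pad.map fun _ => one)

theorem primrec_normalize (f : Fin k → Fin k → Fin k × Fin k) (one : Fin k) :
    Primrec₂ (normalize f one) :=
  Primrec.list_foldr (h := fun _ x => mulNF f x.1 x.2) Primrec.fst
    (Primrec.list_map Primrec.snd (Primrec₂.const one))
    ((primrec_mulNF f).comp (Primrec.fst.comp Primrec.snd) (Primrec.snd.comp Primrec.snd))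

theorem normalize_length (f : Fin k → Fin k → Fin k × Fin k) (one : Fin k)
    (l pad : List (Fin k)) : (normalize f one l pad).length = l.length + pad.length := by
  induction l with
  | nil => simp [normalize]
  | cons s l ih =>
    rw [normalize, List.foldr_cons, mulNF_length]
    rw [normalize] at ih
    rw [ih, List.length_cons]
    omega

theorem spell_mem {e : Fin k → G} (he : Set.range e = S) (l : List (Fin k)) :
    spell e l ∈ Submonoid.closure S := by
  refine list_prod_mem fun x hx => ?_
  obtain ⟨s, -, rfl⟩ := List.mem_map.1 hx
  exact Submonoid.subset_closure (he ▸ Set.mem_range_self s)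

theorem exists_spell {e : Fin k → G} (he : Set.range e = S) {x : G}
    (hx : x ∈ Submonoid.closure S) : ∃ l, spell e l = x := by
  induction hx using Submonoid.closure_induction with
  | mem x hx =>
    rw [← he] at hx
    obtain ⟨s, rfl⟩ := hx
    exact ⟨[s], by simp⟩
  | one => exact ⟨[], rfl⟩
  | mul x y _ _ ihx ihy =>
    obtain ⟨l, rfl⟩ := ihx
    obtain ⟨l', rfl⟩ := ihy
    exact ⟨l ++ l', by simp⟩

namespace IsGarside

/-- For simple t and s and the head h of ts, t divides h. Hence Δ(h⁻¹ts)⁻¹ = (Δs⁻¹)(t⁻¹h) is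
positive, so the remainder h⁻¹ts is a right divisor of Δ and therefore simple. -/
theorem exists_headTable (hG : IsGarside S Δ) {e : Fin k → G} (he : Set.range e = S) :
    ∃ f, IsHeadTable S e f := by
  have hmem : ∀ s, e s ∈ S := fun s => he ▸ Set.mem_range_self s
  have : ∀ t s, ∃ p : Fin k × Fin k, e t * e s = e p.1 * e p.2 ∧
      IsHead S (e t * e s) (e p.1) := by
    intro t s
    have ht := Submonoid.subset_closure (hmem t)
    have hs := Submonoid.subset_closure (hmem s)
    obtain ⟨h, hh⟩ := hG.exists_isHead (mul_mem ht hs)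
    have hth : PosDvd S (e t) h := hh.2.2 _ (hmem t) (posDvd_mul_right hs)
    have hrem : h⁻¹ * (e t * e s) ∈ S := by
      refine hG.mem_simples_iff_right.2 ⟨hh.2.1, ?_⟩
      have := mul_mem (hG.mem_simples_iff_right.1 (hmem s)).2 hth
      rwa [show Δ * (h⁻¹ * (e t * e s))⁻¹ = Δ * (e s)⁻¹ * ((e t)⁻¹ * h) by group]
    have hh1 := hh.1
    rw [← he] at hrem hh1
    obtain ⟨b, hb⟩ := hrem
    obtain ⟨a, rfl⟩ := hh1
    exact ⟨(a, b), by rw [hb]; group, hh⟩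
  choose f hf using this
  exact ⟨f, hf⟩

theorem isHead_self {s : G} (hs : s ∈ S) : IsHead S s s :=
  ⟨hs, PosDvd.refl s, fun _ _ h => h⟩

theorem isNF_mulNF (hG : IsGarside S Δ) {e : Fin k → G} (he : Set.range e = S)
    {f : Fin k → Fin k → Fin k × Fin k} (hf : IsHeadTable S e f) (t : Fin k)
    {l : List (Fin k)} (hl : IsNF S e l) :
    IsNF S e (mulNF f t l) ∧ spell e (mulNF f t l) = e t * spell e l := by
  have hmem : ∀ s, e s ∈ S := fun s => he ▸ Set.mem_range_self s
  induction l generalizing t with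
  | nil =>
    refine ⟨⟨?_, trivial⟩, by simp [mulNF]⟩
    simpa using isHead_self (hmem t)
  | cons s l ih =>
    obtain ⟨h1, h2⟩ := ih (f t s).2 hl.2
    have heq : e (f t s).1 * (e (f t s).2 * spell e l) = e t * (e s * spell e l) := by
      rw [← mul_assoc, ← (hf t s).1, mul_assoc]
    refine ⟨⟨?_, h1⟩, by simp [mulNF, h2, heq]⟩
    rw [h2, heq]
    -- As s is the head of the old product, the head of the new one depends only on t and s and can
    -- be read off the table.
    exact hG.isHead_mul (Submonoid.subset_closure (hmem t))
      (mul_mem (Submonoid.subset_closure (hmem s)) (spell_mem he l)) hl.1 (hf t s).2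

theorem isNF_normalize (hG : IsGarside S Δ) {e : Fin k → G} (he : Set.range e = S)
    {f : Fin k → Fin k → Fin k × Fin k} (hf : IsHeadTable S e f) {one : Fin k}
    (h1 : e one = 1) (l pad : List (Fin k)) :
    IsNF S e (normalize f one l pad) ∧ spell e (normalize f one l pad) = spell e l := by
  induction l with
  | nil =>
    have hs : ∀ pad : List (Fin k), spell e (pad.map fun _ => one) = 1 := fun pad => by
      rw [spell_map_const, h1, one_pow]
    refine ⟨?_, hs pad⟩
    induction pad with
    | nil => trivial
    | cons a pad ih =>
      refine ⟨?_, ih⟩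
      rw [hs, h1, mul_one]
      exact isHead_self hG.one_mem_simples
  | cons s l ih =>
    have := hG.isNF_mulNF he hf s ih.1
    rw [ih.2] at this
    exact ⟨this.1, by rw [spell_cons]; exact this.2⟩

theorem isNF_unique (hG : IsGarside S Δ) {e : Fin k → G} (hinj : Function.Injective e)
    {l l' : List (Fin k)} (hl : IsNF S e l) (hl' : IsNF S e l') (hlen : l.length = l'.length)
    (h : spell e l = spell e l') : l = l' := by
  induction l generalizing l' with
  | nil => exact (List.eq_nil_of_length_eq_zero hlen.symm).symm
  | cons s l ih =>
    cases l' with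
    | nil => simp at hlen
    | cons s' l' =>
      rw [spell_cons, spell_cons] at h
      have hhead := hl.1
      rw [h] at hhead
      obtain rfl := hinj (hG.isHead_unique hhead hl'.1)
      rw [ih hl.2 hl'.2 (by simpa using hlen) (mul_left_cancel h)]

/-- While Δ divides the remaining product, its head is Δ. If the list runs out first, the remaining
power of Δ divides 1 and so equals 1. -/
theorem eq_pow_mul_spell_drop (hG : IsGarside S Δ) {e : Fin k → G} {l : List (Fin k)}
    (hl : IsNF S e l) {j : ℕ} (h : PosDvd S (Δ ^ j) (spell e l)) :
    spell e l = Δ ^ j * spell e (l.drop j) := by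
  induction j generalizing l with
  | zero => simp
  | succ j ih =>
    cases l with
    | nil =>
      have : Δ ^ (j + 1) = 1 := hG.eq_one_of_inv_mem (pow_mem hG.delta_mem _)
        (by simpa [PosDvd] using h)
      simp [this]
    | cons s l =>
      have hd : PosDvd S Δ (e s * spell e l) := by
        rw [← spell_cons]
        refine PosDvd.trans ?_ h
        rw [pow_succ']
        exact posDvd_mul_right (pow_mem hG.delta_mem _)
      have hs : e s = Δ := hG.posDvd_antisymm (hG.mem_simples_iff_left.1 hl.1.1).2
        (hl.1.2.2 _ hG.delta_mem_simples hd)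
      rw [spell_cons, hs, pow_succ', posDvd_mul_left_iff] at h
      rw [spell_cons, hs, ih hl.2 h, pow_succ', List.drop_succ_cons, mul_assoc]

theorem primrec_spell_eq (hG : IsGarside S Δ) {e : Fin k → G} (he : Set.range e = S)
    (hinj : Function.Injective e) :
    PrimrecRel fun l l' : List (Fin k) => spell e l = spell e l' := by
  obtain ⟨f, hf⟩ := hG.exists_headTable he
  obtain ⟨one, h1⟩ : (1 : G) ∈ Set.range e := he ▸ hG.one_mem_simples
  have hn := primrec_normalize f one
  -- Each word is padded by the length of the other, since uniqueness holds only for normal forms of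
  -- equal length.
  refine (Primrec.eq.comp₂ hn (hn.comp₂ Primrec₂.right Primrec₂.left)).of_eq fun l l' => ?_
  have hl := hG.isNF_normalize he hf h1 l l'
  have hl' := hG.isNF_normalize he hf h1 l' l
  constructor
  · intro h
    rw [← hl.2, ← hl'.2, h]
  · intro h
    refine hG.isNF_unique hinj hl.1 hl'.1 ?_ (by rw [hl.2, hl'.2, h])
    rw [normalize_length, normalize_length, add_comm]

/-- By `eq_pow_mul_spell_drop`, divisibility by Δ^j amounts to an equality of two positive words. -/
theorem primrec_posDvd_spell (hG : IsGarside S Δ) {e : Fin k → G} (he : Set.range e = S)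
    (hinj : Function.Injective e) :
    PrimrecRel fun (j : ℕ) (l : List (Fin k)) => PosDvd S (Δ ^ j) (spell e l) := by
  obtain ⟨f, hf⟩ := hG.exists_headTable he
  obtain ⟨one, h1⟩ : (1 : G) ∈ Set.range e := he ▸ hG.one_mem_simples
  obtain ⟨d, hd⟩ : Δ ∈ Set.range e := he ▸ hG.delta_mem_simples
  have hrep : Primrec fun j : ℕ => (List.range j).map fun _ => d :=
    Primrec.list_map Primrec.list_range (Primrec₂.const d)
  have hn : Primrec fun l : List (Fin k) => normalize f one l [] :=
    (primrec_normalize f one).comp Primrec.id (Primrec.const [])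
  refine ((hG.primrec_spell_eq he hinj).comp₂ Primrec₂.right
    (Primrec.list_append.comp₂ (hrep.comp₂ Primrec₂.left)
      (Primrec.list_drop.comp₂ Primrec₂.left (hn.comp₂ Primrec₂.right)))).of_eq fun j l => ?_
  have hl := hG.isNF_normalize he hf h1 l []
  rw [spell_append, spell_map_const, hd, List.length_range]
  constructor
  · intro h
    rw [h]
    exact posDvd_mul_right (spell_mem he _)
  · intro h
    rw [← hl.2] at h ⊢
    exact hG.eq_pow_mul_spell_drop hl.1 h

end IsGarside

end NormalForm

/-! ### Deciding equality and the order on words for elements of G. -/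

section WordProblem

variable {G : Type*} [Group G] {S : Set G} {Δ : G} {n k : ℕ}

@[simp] theorem evalWord_nil (g : Fin n → G) : evalWord g [] = 1 := rfl

@[simp] theorem evalWord_cons (g : Fin n → G) (x : Fin n × Bool) (w : GWord n) :
    evalWord g (x :: w) = cond x.2 (g x.1) (g x.1)⁻¹ * evalWord g w := by simp [evalWord]

@[simp] theorem evalWord_append (g : Fin n → G) (w w' : GWord n) :
    evalWord g (w ++ w') = evalWord g w * evalWord g w' := by simp [evalWord]

/-- The formal inverse of a word. -/
def invWord (w : GWord n) : GWord n := (w.map fun x => (x.1, !x.2)).reverse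

theorem invWord_length (w : GWord n) : (invWord w).length = w.length := by simp [invWord]

theorem evalWord_invWord (g : Fin n → G) (w : GWord n) :
    evalWord g (invWord w) = (evalWord g w)⁻¹ := by
  induction w with
  | nil => simp [invWord]
  | cons x w ih =>
    have : invWord (x :: w) = invWord w ++ [(x.1, !x.2)] := by simp [invWord]
    rw [this, evalWord_append, ih]
    obtain ⟨i, _ | _⟩ := x <;> simp

theorem primrec_invWord : Primrec (invWord (n := n)) :=
  Primrec.list_reverse.comp (Primrec.list_map Primrec.id
    ((Primrec.dom_finite fun x : Fin n × Bool => (x.1, !x.2)).comp Primrec.snd))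

theorem exists_evalWord {g : Fin n → G} (hg : Subgroup.closure (Set.range g) = ⊤) (x : G) :
    ∃ w, evalWord g w = x := by
  have hx : x ∈ Subgroup.closure (Set.range g) := hg ▸ Subgroup.mem_top x
  induction hx using Subgroup.closure_induction with
  | mem x hx =>
    obtain ⟨i, rfl⟩ := hx
    exact ⟨[(i, true)], by simp⟩
  | one => exact ⟨[], rfl⟩
  | mul x y _ _ ihx ihy =>
    obtain ⟨w, rfl⟩ := ihx
    obtain ⟨w', rfl⟩ := ihy
    exact ⟨w ++ w', by simp⟩
  | inv x _ ih =>
    obtain ⟨w, rfl⟩ := ih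
    exact ⟨invWord w, evalWord_invWord g w⟩

namespace IsGarside

/-- A central power of `Δ` turns finitely many given elements into positive ones. -/
theorem exists_central_pow_mul_mem (hG : IsGarside S Δ) {ι : Type*} [Fintype ι] (x : ι → G) :
    ∃ N : ℕ, (∀ y, Commute (Δ ^ N) y) ∧ ∀ i, Δ ^ N * x i ∈ Submonoid.closure S := by
  obtain ⟨N, hN, hc⟩ := hG.exists_pow_central
  have : ∀ i, ∃ m : ℕ, ∀ m' ≥ m, x i * Δ ^ m' ∈ Submonoid.closure S := fun i => by
    obtain ⟨a, ha, b, hb, h⟩ := hG.fractions (x i)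
    obtain ⟨m, hm⟩ := hG.exists_posDvd_pow hb
    refine ⟨m, fun m' hm' => ?_⟩
    rw [h, mul_assoc]
    exact mul_mem ha (hG.posDvd_pow_mono hm' hm)
  choose m hm using this
  have hc' : ∀ y, Commute (Δ ^ (N * ∑ i, m i)) y := fun y => by
    rw [pow_mul]; exact (hc y).pow_left _
  refine ⟨N * ∑ i, m i, hc', fun i => ?_⟩
  rw [(hc' (x i)).eq]
  exact hm i _ ((Finset.single_le_sum (fun _ _ => Nat.zero_le _) (Finset.mem_univ i)).trans
    (Nat.le_mul_of_pos_left _ hN))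

/-- Letters are positive up to a central power of `Δ`. -/
theorem exists_letter_spelling (hG : IsGarside S Δ) {e : Fin k → G} (he : Set.range e = S)
    (g : Fin n → G) : ∃ (N : ℕ) (W : Fin n × Bool → List (Fin k)), (∀ y, Commute (Δ ^ N) y) ∧
      ∀ x, Δ ^ N * cond x.2 (g x.1) (g x.1)⁻¹ = spell e (W x) := by
  obtain ⟨N, hc, h⟩ := hG.exists_central_pow_mul_mem
    fun x : Fin n × Bool => cond x.2 (g x.1) (g x.1)⁻¹
  choose W hW using fun x => exists_spell he (h x)
  exact ⟨N, W, hc, fun x => (hW x).symm⟩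

end IsGarside

theorem pow_mul_evalWord {e : Fin k → G} {g : Fin n → G} {z : G} (hz : ∀ y, Commute z y)
    {W : Fin n × Bool → List (Fin k)}
    (hW : ∀ x, z * cond x.2 (g x.1) (g x.1)⁻¹ = spell e (W x)) (w : GWord n) :
    z ^ w.length * evalWord g w = spell e (w.flatMap W) := by
  induction w with
  | nil => simp
  | cons x w ih =>
    rw [List.flatMap_cons, spell_append, ← hW, ← ih, evalWord_cons, List.length_cons, pow_succ']
    rw [mul_assoc, mul_assoc, ← mul_assoc (z ^ w.length), ((hz _).pow_left _).eq, mul_assoc]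

theorem spell_flatMap_const {α : Type*} (e : Fin k → G) (L : List (Fin k)) (l : List α) :
    spell e (l.flatMap fun _ => L) = spell e L ^ l.length := by
  induction l with
  | nil => simp
  | cons a l ih => rw [List.flatMap_cons, spell_append, ih, List.length_cons, pow_succ']

theorem primrec_int_toNat : Primrec Int.toNat := by
  -- The code of an integer is 2a for a ≥ 0 and 2a + 1 for -(a + 1), so its parity is the sign.
  have : Primrec fun c : ℕ => cond c.bodd 0 c.div2 :=
    Primrec.cond Primrec.nat_bodd (Primrec.const 0) Primrec.nat_div2
  refine (this.comp Primrec.encode).of_eq fun m => ?_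
  cases m with
  | ofNat a =>
    have : Encodable.encode (a : ℤ) = 2 * a := rfl
    simp [this]
  | negSucc a =>
    have : Encodable.encode (Int.negSucc a) = 2 * a + 1 := rfl
    simp [this]

theorem primrec_int_neg_toNat : Primrec fun m : ℤ => (-m).toNat := by
  have : Primrec fun c : ℕ => cond c.bodd (c.div2 + 1) 0 :=
    Primrec.cond Primrec.nat_bodd (Primrec.succ.comp Primrec.nat_div2) (Primrec.const 0)
  refine (this.comp Primrec.encode).of_eq fun m => ?_
  cases m with
  | ofNat a =>
    have : Encodable.encode (a : ℤ) = 2 * a := rfl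
    simp [this]
  | negSucc a =>
    have : Encodable.encode (Int.negSucc a) = 2 * a + 1 := rfl
    simp [this, Int.neg_negSucc]

theorem primrec_int_ofNat : Primrec Int.ofNat :=
  Primrec.encode_iff.1 <| Primrec.nat_double.of_eq fun _ => rfl

theorem primrec_int_negSucc : Primrec Int.negSucc :=
  Primrec.encode_iff.1 <| Primrec.nat_double_succ.of_eq fun _ => rfl

namespace IsGarside

/-- The simple elements indexed by an initial segment of the natural numbers. -/
theorem exists_enumeration (hG : IsGarside S Δ) :
    ∃ (k : ℕ) (e : Fin k → G), Function.Injective e ∧ Set.range e = S := by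
  have := hG.finite_simples.to_subtype
  obtain ⟨k, ⟨φ⟩⟩ := Finite.exists_equiv_fin S
  refine ⟨k, fun i => φ.symm i, Subtype.val_injective.comp φ.symm.injective, ?_⟩
  rw [show (fun i => ((φ.symm i : S) : G)) = Subtype.val ∘ φ.symm from rfl,
    φ.symm.surjective.range_comp, Subtype.range_coe]

/-- The word problem is solvable. -/
theorem primrec_evalWord_eq (hG : IsGarside S Δ) (g : Fin n → G) :
    PrimrecRel fun w w' : GWord n => evalWord g w = evalWord g w' := by
  obtain ⟨k, e, hinj, he⟩ := hG.exists_enumeration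
  obtain ⟨N, W, hc, hW⟩ := hG.exists_letter_spelling he g
  obtain ⟨Z, hZ⟩ := exists_spell he (pow_mem hG.delta_mem N)
  have hW' : Primrec fun w : GWord n => w.flatMap W :=
    Primrec.list_flatMap Primrec.id ((Primrec.dom_finite W).comp Primrec.snd)
  have hZ' : Primrec fun w : GWord n => w.flatMap fun _ => Z :=
    Primrec.list_flatMap Primrec.id (Primrec₂.const Z)
  -- Making w positive costs one factor Δ^N per letter; adding one for each letter of w' equalises
  -- the central power on the two sides.
  have hside : Primrec₂ fun w w' : GWord n => (w'.flatMap fun _ => Z) ++ w.flatMap W :=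
    Primrec.list_append.comp₂ (hZ'.comp₂ Primrec₂.right) (hW'.comp₂ Primrec₂.left)
  refine ((hG.primrec_spell_eq he hinj).comp₂ hside
    (hside.comp₂ Primrec₂.right Primrec₂.left)).of_eq fun w w' => ?_
  simp only [spell_append, spell_flatMap_const, hZ, ← pow_mul_evalWord hc hW]
  rw [← mul_assoc, ← mul_assoc, ← pow_add, ← pow_add, add_comm, mul_right_inj]

/-- Both sides are multiplied by Δ^(N|w|), which makes w positive, and by Δ to the power
`(-m).toNat`, which clears a negative exponent. -/
theorem primrec_pow_gLe (hG : IsGarside S Δ) (g : Fin n → G) :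
    PrimrecRel fun (m : ℤ) (w : GWord n) => GLe S (Δ ^ m) (evalWord g w) := by
  obtain ⟨k, e, hinj, he⟩ := hG.exists_enumeration
  obtain ⟨N, W, hc, hW⟩ := hG.exists_letter_spelling he g
  obtain ⟨d, hd⟩ : Δ ∈ Set.range e := he ▸ hG.delta_mem_simples
  have hW' : Primrec fun w : GWord n => w.flatMap W :=
    Primrec.list_flatMap Primrec.id ((Primrec.dom_finite W).comp Primrec.snd)
  have hrep : Primrec fun m : ℤ => (List.range (-m).toNat).map fun _ => d :=
    Primrec.list_map (Primrec.list_range.comp primrec_int_neg_toNat) (Primrec₂.const d)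
  have hlen : Primrec fun w : GWord n => N * w.length :=
    Primrec.nat_mul.comp (Primrec.const N) Primrec.list_length
  refine ((hG.primrec_posDvd_spell he hinj).comp₂
    (Primrec.nat_add.comp₂ (hlen.comp₂ Primrec₂.right) (primrec_int_toNat.comp₂ Primrec₂.left))
    (Primrec.list_append.comp₂ (hrep.comp₂ Primrec₂.left)
      (hW'.comp₂ Primrec₂.right))).of_eq fun m w => ?_
  rw [hG.pow_gLe_iff, spell_append, spell_map_const, hd, List.length_range,
    ← pow_mul_evalWord hc hW, ← mul_assoc, ← (((hc _).pow_left w.length).eq), mul_assoc, pow_add,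
    pow_mul, posDvd_mul_left_iff]
  have e1 : Δ ^ m.toNat = Δ ^ (-m).toNat * Δ ^ m := by
    rw [← zpow_natCast, ← zpow_natCast, ← zpow_add]
    congr 1
    omega
  rw [e1, posDvd_mul_left_iff]

theorem primrec_gLe_pow (hG : IsGarside S Δ) (g : Fin n → G) :
    PrimrecRel fun (w : GWord n) (m : ℤ) => GLe S (evalWord g w) (Δ ^ m) := by
  obtain ⟨k, e, hinj, he⟩ := hG.exists_enumeration
  have hneg : Primrec fun m : ℤ => -m := by
    have h : Primrec fun m : ℤ => (Nat.casesOn m.toNat (Int.ofNat (-m).toNat) fun b => Int.negSucc b : ℤ) :=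
      Primrec.nat_casesOn primrec_int_toNat (primrec_int_ofNat.comp primrec_int_neg_toNat)
        (primrec_int_negSucc.comp₂ Primrec₂.right)
    refine h.of_eq fun m => ?_
    obtain ⟨_ | a⟩ | a := m <;> rfl
  refine ((hG.primrec_pow_gLe g).comp₂ (hneg.comp₂ Primrec₂.right)
    (primrec_invWord.comp₂ Primrec₂.left)).of_eq fun w m => ?_
  rw [evalWord_invWord, hG.gLe_pow_iff, hG.pow_gLe_iff]

end IsGarside

end WordProblem

/-! ### Unbounded search and primitive recursive predicates on lists. -/

section Computability

variable {α β : Type*} [Primcodable α] [Primcodable β]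

/-- A total search for a witness of a primitive recursive relation is computable. -/
theorem exists_computable_of_forall_exists {R : α → β → Prop} (hR : PrimrecRel R)
    (h : ∀ a, ∃ b, R a b) : ∃ f : α → β, Computable f ∧ ∀ a, R a (f a) := by
  classical
  let F : α → ℕ → Option β := fun a c => (Encodable.decode c).bind fun b =>
    if R a b then some b else none
  have hF : Primrec₂ F := by
    refine Primrec.option_bind (Primrec.decode.comp Primrec.snd) ?_
    exact Primrec.ite (hR.comp (Primrec.fst.comp Primrec.fst) Primrec.snd)
      (Primrec.option_some.comp Primrec.snd) (Primrec.const none)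
  have hspec : ∀ a c b, b ∈ F a c → R a b := by
    intro a c b hb
    obtain ⟨b', -, hb'⟩ := Option.bind_eq_some_iff.1 hb
    split_ifs at hb' with hab
    rwa [← Option.some.inj hb']
  have hdom : ∀ a, (Nat.rfindOpt (F a)).Dom := by
    intro a
    obtain ⟨b, hb⟩ := h a
    exact Nat.rfindOpt_dom.2 ⟨Encodable.encode b, b, by simp [F, hb]⟩
  refine ⟨fun a => (Nat.rfindOpt (F a)).get (hdom a), ?_, fun a => ?_⟩
  · exact (Partrec.rfindOpt hF.to_comp).of_eq_tot fun a => Part.get_mem _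
  · obtain ⟨c, hc⟩ := Nat.rfindOpt_spec (Part.get_mem (hdom a))
    exact hspec a c _ hc

theorem PrimrecRel.list_forall₂ {R : α → β → Prop} (hR : PrimrecRel R) :
    PrimrecRel (List.Forall₂ R) := by
  classical
  have hcell : PrimrecRel fun (i : ℕ) (x : List α × List β) =>
      ((x.1[i]?).bind fun a => (x.2[i]?).map fun b => decide (R a b)) = some true := by
    refine Primrec.eq.comp (Primrec.option_bind
      (Primrec.list_getElem?.comp (Primrec.fst.comp Primrec.snd) Primrec.fst) ?_)
      (Primrec.const (some true))
    refine Primrec.option_map (Primrec.list_getElem?.comp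
      (Primrec.snd.comp (Primrec.snd.comp Primrec.fst)) (Primrec.fst.comp Primrec.fst)) ?_
    exact hR.decide.comp (Primrec.snd.comp Primrec.fst) Primrec.snd
  have hall := hcell.forall_mem_list.comp
    (Primrec.list_range.comp (Primrec.list_length.comp Primrec.fst)) Primrec.id
  refine PrimrecPred.of_eq ((Primrec.eq.comp (Primrec.list_length.comp Primrec.fst)
    (Primrec.list_length.comp Primrec.snd)).and hall) ?_
  rintro ⟨l, l'⟩
  rw [List.forall₂_iff_get]
  refine and_congr_right fun hlen => ?_
  simp only [List.mem_range, id]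
  constructor
  · intro h i h1 h2
    simpa [h1, h2] using h i h1
  · intro h i h1
    have h2 : i < l'.length := hlen ▸ h1
    simpa [h1, h2] using h i h1 h2

theorem PrimrecPred.imp {p q : α → Prop} (hp : PrimrecPred p) (hq : PrimrecPred q) :
    PrimrecPred fun a => p a → q a :=
  (hp.not.or hq).of_eq fun _ => imp_iff_not_or.symm

theorem forall₂_map_of_forall {α β γ : Type*} {R : β → γ → Prop} {f : α → β} {h : α → γ}
    {l : List α} (H : ∀ a ∈ l, R (f a) (h a)) : List.Forall₂ R (l.map f) (l.map h) := by
  rw [List.forall₂_map_left_iff, List.forall₂_map_right_iff]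
  exact List.forall₂_same.2 H

end Computability

/-! ### Certified lists and the algorithms for tuples. -/

section Tuples

variable {G : Type*} [Group G] {S : Set G} {Δ : G} {n : ℕ}

/-- Conjugation of a tuple of words by a word. -/
def conjWords (u : List (GWord n)) (w : GWord n) : List (GWord n) :=
  u.map fun y => invWord w ++ y ++ w

theorem evalTuple_conjWords (g : Fin n → G) (u : List (GWord n)) (w : GWord n) :
    evalTuple g (conjWords u w) = conjTuple (evalTuple g u) (evalWord g w) := by
  simp [evalTuple, conjWords, conjTuple, evalWord_invWord, mul_assoc]

theorem primrec_conjWords : Primrec₂ (conjWords (n := n)) := by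
  have hw : Primrec fun x : (List (GWord n) × GWord n) × GWord n => x.1.2 :=
    Primrec.snd.comp Primrec.fst
  exact Primrec.list_map Primrec.fst (Primrec.list_append.comp
    (Primrec.list_append.comp (primrec_invWord.comp hw) Primrec.snd) hw)

theorem exists_evalTuple {g : Fin n → G} (hg : Subgroup.closure (Set.range g) = ⊤)
    (a : List G) : ∃ u, evalTuple g u = a := by
  choose w hw using exists_evalWord hg
  exact ⟨a.map w, by simp [evalTuple, Function.comp_def, hw]⟩

theorem pow_mul_evalWord_mem {g : Fin n → G} {z : G} (hz : ∀ y, Commute z y)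
    (h : ∀ x : Fin n × Bool, z * cond x.2 (g x.1) (g x.1)⁻¹ ∈ Submonoid.closure S)
    (w : GWord n) : z ^ w.length * evalWord g w ∈ Submonoid.closure S := by
  induction w with
  | nil => simp [one_mem]
  | cons x w ih =>
    have := mul_mem (h x) ih
    rwa [evalWord_cons, List.length_cons, pow_succ', mul_assoc, ← mul_assoc (z ^ w.length),
      ((hz _).pow_left _).eq, mul_assoc, ← mul_assoc z]

/-- `L` certifies its own completeness as a list of the part of the conjugacy class of `u` inside
a box: it contains `u` and is closed under conjugation by the elements spelled by `T`. -/
def IsClassList (S : Set G) (Δ : G) (g : Fin n → G) (T : List (GWord n))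
    (u : List (GWord n)) (p q : List ℤ) (L : List (List (GWord n) × GWord n)) : Prop :=
  (∃ t ∈ L, evalTuple g t.1 = evalTuple g u) ∧
  (∀ t ∈ L, evalTuple g t.1 = evalTuple g (conjWords u t.2) ∧ evalTuple g t.1 ∈ box S Δ p q) ∧
  ∀ t ∈ L, ∀ s ∈ T, evalTuple g (conjWords t.1 s) ∈ box S Δ p q →
    ∃ t' ∈ L, evalTuple g t'.1 = evalTuple g (conjWords t.1 s)

namespace IsGarside

theorem primrec_evalTuple_eq (hG : IsGarside S Δ) (g : Fin n → G) :
    PrimrecRel fun u v : List (GWord n) => evalTuple g u = evalTuple g v :=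
  (PrimrecRel.list_forall₂ (hG.primrec_evalWord_eq g)).of_eq fun u v => by
    rw [← List.forall₂_eq_eq_eq, evalTuple, evalTuple, List.forall₂_map_left_iff,
      List.forall₂_map_right_iff]

theorem primrec_mem_box (hG : IsGarside S Δ) (g : Fin n → G) :
    PrimrecRel fun (u : List (GWord n)) (b : List ℤ × List ℤ) =>
      evalTuple g u ∈ box S Δ b.1 b.2 := by
  refine PrimrecPred.of_eq (((PrimrecRel.list_forall₂ (hG.primrec_pow_gLe g)).comp
    (Primrec.fst.comp Primrec.snd) Primrec.fst).and
    ((PrimrecRel.list_forall₂ (hG.primrec_gLe_pow g)).comp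
      Primrec.fst (Primrec.snd.comp Primrec.snd))) ?_
  rintro ⟨u, p, q⟩
  simp [box, evalTuple, List.forall₂_map_left_iff, List.forall₂_map_right_iff]

theorem primrec_isClassList (hG : IsGarside S Δ) (g : Fin n → G) (T : List (GWord n)) :
    PrimrecRel fun (x : List (GWord n) × (List ℤ × List ℤ))
      (L : List (List (GWord n) × GWord n)) => IsClassList S Δ g T x.1 x.2.1 x.2.2 L := by
  have hEq := hG.primrec_evalTuple_eq g
  have hBox := hG.primrec_mem_box g
  have h1 : PrimrecRel fun (t : List (GWord n) × GWord n) (u : List (GWord n)) =>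
      evalTuple g t.1 = evalTuple g u :=
    hEq.comp (Primrec.fst.comp Primrec.fst) Primrec.snd
  have h2 : PrimrecRel fun (t : List (GWord n) × GWord n)
      (x : List (GWord n) × (List ℤ × List ℤ)) =>
      evalTuple g t.1 = evalTuple g (conjWords x.1 t.2) ∧
        evalTuple g t.1 ∈ box S Δ x.2.1 x.2.2 :=
    (hEq.comp (Primrec.fst.comp Primrec.fst) (primrec_conjWords.comp
      (Primrec.fst.comp Primrec.snd) (Primrec.snd.comp Primrec.fst))).and
      (hBox.comp (Primrec.fst.comp Primrec.fst) (Primrec.snd.comp Primrec.snd))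
  have h3 : PrimrecRel fun (s : GWord n) (y : (List (GWord n) × GWord n) ×
      ((List ℤ × List ℤ) × List (List (GWord n) × GWord n))) =>
      evalTuple g (conjWords y.1.1 s) ∈ box S Δ y.2.1.1 y.2.1.2 →
        ∃ t' ∈ y.2.2, evalTuple g t'.1 = evalTuple g (conjWords y.1.1 s) := by
    have hc : Primrec fun x : GWord n × ((List (GWord n) × GWord n) ×
        ((List ℤ × List ℤ) × List (List (GWord n) × GWord n))) => conjWords x.2.1.1 x.1 :=
      primrec_conjWords.comp (Primrec.fst.comp (Primrec.fst.comp Primrec.snd)) Primrec.fst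
    have hy : Primrec fun x : GWord n × ((List (GWord n) × GWord n) ×
        ((List ℤ × List ℤ) × List (List (GWord n) × GWord n))) => x.2.2 :=
      Primrec.snd.comp Primrec.snd
    exact PrimrecPred.imp (hBox.comp hc (Primrec.fst.comp hy))
      (h1.exists_mem_list.comp (Primrec.snd.comp hy) hc)
  have h4 : PrimrecRel fun (t : List (GWord n) × GWord n)
      (y : (List ℤ × List ℤ) × List (List (GWord n) × GWord n)) =>
      ∀ s ∈ T, evalTuple g (conjWords t.1 s) ∈ box S Δ y.1.1 y.1.2 →
        ∃ t' ∈ y.2, evalTuple g t'.1 = evalTuple g (conjWords t.1 s) :=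
    h3.forall_mem_list.comp (Primrec.const T) Primrec.id
  exact (h1.exists_mem_list.comp Primrec.snd (Primrec.fst.comp Primrec.fst)).and
    ((h2.forall_mem_list.comp Primrec.snd Primrec.fst).and
      (h4.forall_mem_list.comp Primrec.snd
        ((Primrec.snd.comp Primrec.fst).pair Primrec.snd)))

/-- Completeness is where connectedness enters: a list containing the tuple and closed under simple
steps in the box contains every tuple reachable by them, hence the whole class in the box. -/
theorem isClassList_spec (hG : IsGarside S Δ) {g : Fin n → G} {T : List (GWord n)}
    (hT : ∀ s : G, s ∈ S ↔ ∃ w ∈ T, evalWord g w = s) {u : List (GWord n)} {p q : List ℤ}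
    (hu : evalTuple g u ∈ box S Δ p q) {L : List (List (GWord n) × GWord n)}
    (hL : IsClassList S Δ g T u p q L) :
    {c | ∃ t ∈ L, evalTuple g t.1 = c} = conjClass (evalTuple g u) ∩ box S Δ p q ∧
      ∀ t ∈ L, conjTuple (evalTuple g u) (evalWord g t.2) = evalTuple g t.1 := by
  obtain ⟨h1, h2, h3⟩ := hL
  have hconj : ∀ t ∈ L, conjTuple (evalTuple g u) (evalWord g t.2) = evalTuple g t.1 :=
    fun t ht => by rw [(h2 t ht).1, evalTuple_conjWords]
  refine ⟨Set.Subset.antisymm ?_ ?_, hconj⟩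
  · rintro c ⟨t, ht, rfl⟩
    exact ⟨⟨_, hconj t ht⟩, (h2 t ht).2⟩
  · rw [hG.conjClass_inter_box hu]
    intro c hc
    induction hc with
    | refl => exact h1
    | tail _ hs ih =>
      obtain ⟨t, ht, rfl⟩ := ih
      obtain ⟨⟨s, hs, rfl⟩, hb⟩ := hs
      obtain ⟨w, hw, rfl⟩ := (hT s).1 hs
      rw [← evalTuple_conjWords] at hb ⊢
      exact h3 t ht w hw hb

theorem exists_isClassList (hG : IsGarside S Δ) {g : Fin n → G}
    (hg : Subgroup.closure (Set.range g) = ⊤) (T : List (GWord n))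
    {u : List (GWord n)} {p q : List ℤ}
    (hu : evalTuple g u ∈ box S Δ p q) : ∃ L, IsClassList S Δ g T u p q L := by
  have hfin : (conjClass (evalTuple g u) ∩ box S Δ p q).Finite :=
    (hG.finite_box p q).subset Set.inter_subset_right
  have hw : ∀ c : List G, ∃ t : List (GWord n) × GWord n, evalTuple g t.1 = c ∧
      (c ∈ conjClass (evalTuple g u) → evalTuple g t.1 = evalTuple g (conjWords u t.2)) := by
    intro c
    obtain ⟨v, rfl⟩ := exists_evalTuple hg c
    by_cases h : evalTuple g v ∈ conjClass (evalTuple g u)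
    · obtain ⟨x, hx⟩ := h
      obtain ⟨w, rfl⟩ := exists_evalWord hg x
      exact ⟨(v, w), rfl, fun _ => by rw [evalTuple_conjWords, hx]⟩
    · exact ⟨(v, []), rfl, fun h' => absurd h' h⟩
  choose F hF hF' using hw
  have hmem : ∀ c, c ∈ conjClass (evalTuple g u) → c ∈ box S Δ p q →
      ∃ t ∈ hfin.toFinset.toList.map F, evalTuple g t.1 = c := fun c h h' =>
    ⟨F c, List.mem_map_of_mem (by simpa using ⟨h, h'⟩), hF c⟩
  have hback : ∀ t ∈ hfin.toFinset.toList.map F, evalTuple g t.1 ∈ conjClass (evalTuple g u) ∧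
      evalTuple g t.1 = evalTuple g (conjWords u t.2) ∧ evalTuple g t.1 ∈ box S Δ p q := by
    intro t ht
    obtain ⟨c, hc, rfl⟩ := List.mem_map.1 ht
    obtain ⟨h, h'⟩ : c ∈ conjClass (evalTuple g u) ∧ c ∈ box S Δ p q := by simpa using hc
    exact ⟨by rwa [hF], hF' c h, by rwa [hF]⟩
  refine ⟨hfin.toFinset.toList.map F, hmem _ ⟨1, conjTuple_one _⟩ hu,
    fun t ht => (hback t ht).2, fun t ht s _ hb => hmem _ ?_ hb⟩
  obtain ⟨x, hx⟩ := (hback t ht).1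
  exact ⟨x * evalWord g s, by rw [evalTuple_conjWords, conjTuple_mul, hx]⟩

theorem classInBoxComputable (hG : IsGarside S Δ) {g : Fin n → G}
    (hg : Subgroup.closure (Set.range g) = ⊤) : ClassInBoxComputable S Δ g := by
  choose w hw using exists_evalWord hg
  let T : List (GWord n) := hG.finite_simples.toFinset.toList.map w
  have hT : ∀ s : G, s ∈ S ↔ ∃ v ∈ T, evalWord g v = s := by
    intro s
    simp [T, hw]
  -- Membership in the box is made a premise so that the search also stops on inputs outside it.
  have hR : PrimrecRel fun (x : List (GWord n) × (List ℤ × List ℤ))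
      (L : List (List (GWord n) × GWord n)) => evalTuple g x.1 ∈ box S Δ x.2.1 x.2.2 →
        IsClassList S Δ g T x.1 x.2.1 x.2.2 L :=
    PrimrecPred.imp ((hG.primrec_mem_box g).comp (Primrec.fst.comp Primrec.fst)
      (Primrec.snd.comp Primrec.fst)) (hG.primrec_isClassList g T)
  obtain ⟨f, hf, hfR⟩ := exists_computable_of_forall_exists hR fun x => by
    by_cases hx : evalTuple g x.1 ∈ box S Δ x.2.1 x.2.2
    · obtain ⟨L, hL⟩ := hG.exists_isClassList hg T hx
      exact ⟨L, fun _ => hL⟩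
    · exact ⟨[], fun h => absurd h hx⟩
  exact ⟨f, hf, fun u p q hu => hG.isClassList_spec hT hu (hfR (u, (p, q)) hu)⟩

theorem boxComputable (hG : IsGarside S Δ) (g : Fin n → G) : BoxComputable S Δ g := by
  obtain ⟨N, hc, hN⟩ := hG.exists_central_pow_mul_mem
    fun x : Fin n × Bool => cond x.2 (g x.1) (g x.1)⁻¹
  have hpos : ∀ (w : GWord n) (M : ℕ), w.length ≤ M →
      Δ ^ (N * M) * evalWord g w ∈ Submonoid.closure S := by
    intro w M hM
    obtain ⟨j, rfl⟩ := Nat.exists_eq_add_of_le' hM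
    rw [pow_mul, pow_add, mul_assoc]
    exact mul_mem (pow_mem (pow_mem hG.delta_mem _) _) (pow_mul_evalWord_mem hc hN w)
  -- The total length of all the words bounds each of them, so a single exponent serves every
  -- coordinate of both tuples.
  let M : List (GWord n) × List (GWord n) → ℕ := fun t => N * ((t.1 ++ t.2).flatten).length
  have hM : Primrec M := Primrec.nat_mul.comp (Primrec.const N)
    (Primrec.list_length.comp (Primrec.list_flatten.comp
      (Primrec.list_append.comp Primrec.fst Primrec.snd)))
  have key : ∀ (t : List (GWord n) × List (GWord n)) (u l : List (GWord n)),
      l.length = u.length → (∀ w ∈ u, w ∈ t.1 ++ t.2) → evalTuple g u ∈ box S Δ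
        (l.map fun _ => Int.negSucc (M t)) (l.map fun _ => Int.ofNat (M t)) := by
    intro t u l hl hu
    have e : ∀ m : ℤ, (l.map fun _ => m) = u.map fun _ => m := fun m => by
      rw [List.map_const', List.map_const', hl]
    have hlen : ∀ w ∈ u, w.length ≤ ((t.1 ++ t.2).flatten).length := fun w hw =>
      (List.sublist_flatten_of_mem (hu w hw)).length_le
    rw [e, e]
    refine ⟨forall₂_map_of_forall fun w hw => ?_, forall₂_map_of_forall fun w hw => ?_⟩
    · rw [hG.pow_gLe_iff]
      -- The additional Δ accounts for `Int.negSucc (M t)` being -(M t + 1), one below the bound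
      -- that is needed.
      have := mul_mem hG.delta_mem (hpos w _ (hlen w hw))
      rw [← mul_assoc, ← pow_succ'] at this
      rwa [PosDvd, zpow_negSucc, inv_inv]
    · rw [hG.gLe_pow_iff, ← evalWord_invWord]
      have := hpos (invWord w) _ ((invWord_length w).trans_le (hlen w hw))
      rwa [PosDvd, Int.ofNat_eq_natCast, zpow_neg, zpow_natCast, inv_inv]
  refine ⟨fun t => (t.1.map fun _ => Int.negSucc (M t), t.1.map fun _ => Int.ofNat (M t)), ?_,
    fun u v huv => ⟨?_, ?_⟩⟩
  · refine Primrec.to_comp (Primrec.pair ?_ ?_)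
    · exact Primrec.list_map Primrec.fst (primrec_int_negSucc.comp (hM.comp Primrec.fst))
    · exact Primrec.list_map Primrec.fst (primrec_int_ofNat.comp (hM.comp Primrec.fst))
  · exact key (u, v) u u rfl fun w hw => List.mem_append_left _ hw
  · exact key (u, v) v u huv fun w hw => List.mem_append_right _ hw

theorem searchSCPSolvable (hG : IsGarside S Δ) {g : Fin n → G}
    (hg : Subgroup.closure (Set.range g) = ⊤) : SearchSCPSolvable g := by
  classical
  obtain ⟨b, hb, hbox⟩ := hG.boxComputable g
  obtain ⟨f, hf, hlist⟩ := hG.classInBoxComputable hg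
  have hEq : PrimrecRel fun (t : List (GWord n) × GWord n) (v : List (GWord n)) =>
      evalTuple g t.1 = evalTuple g v :=
    (hG.primrec_evalTuple_eq g).comp (Primrec.fst.comp Primrec.fst) Primrec.snd
  have hsel : Primrec₂ fun (L : List (List (GWord n) × GWord n)) (v : List (GWord n)) =>
      ((L.filter fun t => evalTuple g t.1 = evalTuple g v).head?).map Prod.snd :=
    (Primrec.option_map₁ Primrec.snd).comp (Primrec.list_head?.comp hEq.listFilter)
  have hlen : Primrec fun t : List (GWord n) × List (GWord n) =>
      decide (t.1.length = t.2.length) :=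
    (Primrec.eq.comp (Primrec.list_length.comp Primrec.fst)
      (Primrec.list_length.comp Primrec.snd)).decide
  -- Tuples of different lengths are never conjugate, and the box is guaranteed to contain both
  -- tuples only for equal lengths, so lengths are compared before the lookup.
  refine ⟨fun t => cond (decide (t.1.length = t.2.length))
    ((((f (t.1, b t)).filter fun s => evalTuple g s.1 = evalTuple g t.2).head?).map Prod.snd)
    none, ?_, fun u v => ?_⟩
  · exact Computable.cond hlen.to_comp
      (hsel.to_comp.comp (hf.comp (Computable.fst.pair hb)) Computable.snd) (Computable.const none)
  · by_cases huv : u.length = v.length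
    · obtain ⟨hbu, hbv⟩ := hbox u v huv
      obtain ⟨h1, h2⟩ := hlist u _ _ hbu
      simp only [huv, decide_true, cond_true]
      constructor
      · intro w hw
        obtain ⟨t, ht, rfl⟩ := Option.map_eq_some_iff.1 hw
        obtain ⟨ht1, ht2⟩ := List.mem_filter.1 (List.mem_of_mem_head? ht)
        rw [h2 t ht1]
        exact of_decide_eq_true ht2
      · intro hnone hv
        have hv' : evalTuple g v ∈ {c | ∃ t ∈ f (u, ((b (u, v)).1, (b (u, v)).2)),
            evalTuple g t.1 = c} := by
          rw [h1]; exact ⟨hv, hbv⟩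
        obtain ⟨t, ht, htv⟩ := hv'
        rw [Option.map_eq_none_iff, List.head?_eq_none_iff, List.filter_eq_nil_iff] at hnone
        exact hnone t ht (decide_eq_true htv)
    · simp only [huv, decide_false, cond_false]
      refine ⟨fun w hw => (Option.some_ne_none w hw.symm).elim, fun _ => ?_⟩
      rintro ⟨x, hx⟩
      apply huv
      simpa [conjTuple, evalTuple] using congrArg List.length hx

theorem decisionSCPSolvable (hG : IsGarside S Δ) {g : Fin n → G}
    (hg : Subgroup.closure (Set.range g) = ⊤) : DecisionSCPSolvable g := by
  obtain ⟨f, hf, h⟩ := hG.searchSCPSolvable hg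
  refine ComputablePred.computable_iff.2
    ⟨fun t => (f t).isSome, Primrec.option_isSome.to_comp.comp hf, funext fun t => propext ?_⟩
  obtain ⟨h1, h2⟩ := h t.1 t.2
  constructor
  · intro ht
    by_contra hn
    exact h2 (by simpa using hn) ht
  · intro ht
    obtain ⟨w, hw⟩ := Option.isSome_iff_exists.1 ht
    exact ⟨_, h1 w hw⟩

end IsGarside

end Tuples

end GarsideSCP

theorem mainTheorem2 {G : Type*} [Group G] (S : Set G) (Δ : G)
    (hG : GarsideSCP.IsGarside S Δ) {n : ℕ} (g : Fin n → G)
    (hg : Subgroup.closure (Set.range g) = ⊤) :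
    GarsideSCP.DecisionSCPSolvable g ∧
    GarsideSCP.SearchSCPSolvable g ∧
    GarsideSCP.BoxComputable S Δ g ∧
    (∀ (p q : List ℤ) (a : List G), a ∈ GarsideSCP.box S Δ p q →
      (GarsideSCP.conjClass a ∩ GarsideSCP.box S Δ p q).Finite ∧
      GarsideSCP.conjClass a ∩ GarsideSCP.box S Δ p q =
        {c | Relation.ReflTransGen (GarsideSCP.SimpleStep S Δ p q) a c}) ∧
    GarsideSCP.ClassInBoxComputable S Δ g :=
  ⟨hG.decisionSCPSolvable hg, hG.searchSCPSolvable hg, hG.boxComputable g,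
    fun p q _ ha => ⟨(hG.finite_box p q).subset Set.inter_subset_right, hG.conjClass_inter_box ha⟩,
    hG.classInBoxComputable hg⟩
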